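/- Let $R$ be a commutative Noetherian ring and let $\mathfrak a\subseteq R$ be a perfect ideal, i.e. a proper ideal such that $\operatorname{grade}(\mathfrak a)$, the maximal length of an $R$-regular sequence contained in $\mathfrak a$, equals the projective dimension of the $R$-module $R/\mathfrak a$. Assume that for every $k\in\mathbb N=\{0,1,2,\dots\}$ there is a ring homomorphism $\phi_k:R\to R$ such that: 1. $\phi_0=1_R$ is the identity of $R$; 2. $\phi_i(\mathfrak a)\subseteq\phi_j(\mathfrak a)$ whenever $i\ge j$; 3. the system of ideals $\{\phi_k(\mathfrak a)R\}_{k\in\mathbb N}$ is cofinal with $\{\mathfrak a^k\}_{k\in\mathbb N}$, i.e. for every $k$ there is an $l$ with $\mathfrak a^l\subseteq\phi_k(\mathfrak a)R$, and for every $k$ there is an $l$ with $\phi_l(\mathfrak a)R\subseteq\mathfrak a^k$. Then $\operatorname{cd}(R,\mathfrak a)=\operatorname{ht}(\mathfrak a)$, where $\operatorname{ht}(\mathfrak a)$ is the height of $\mathfrak a$ and $\operatorname{cd}(R,\mathfrak a)$, the cohomological dimension, is the least natural number $c$ such that the local cohomology modules $H^i_{\mathfrak a}(M)$ vanish for all $R$-modules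 $M$ and all $i>c$. -/

import Mathlib

universe u

/-- The grade of an ideal `a` of `R`: the supremum of the lengths of the `R`-regular sequences
all of whose entries lie in `a`. -/
noncomputable def Ideal.grade {R : Type u} [CommRing R] (a : Ideal R) : ℕ∞ :=
  ⨆ (rs : List R) (_ : RingTheory.Sequence.IsRegular R rs) (_ : ∀ r ∈ rs, r ∈ a),
    (rs.length : ℕ∞)

/-- An ideal `a` is perfect if `grade a` equals the projective dimension of `R ⧸ a`.
The zero module has projective dimension `⊥`, so a perfect ideal is proper. -/
def Ideal.IsPerfect {R : Type u} [CommRing R] (a : Ideal R) : Prop :=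
  CategoryTheory.projectiveDimension (ModuleCat.of R (R ⧸ a)) = (a.grade : WithBot ℕ∞)

/-- The cohomological dimension of an ideal `a`: the least natural number `c` such that the local
cohomology modules of every `R`-module `M` with support in `a` vanish in all degrees `i > c`
(and `⊤` if there is no such `c`). -/
noncomputable def Ideal.cohomologicalDimension {R : Type u} [CommRing R] (a : Ideal R) : ℕ∞ :=
  ⨅ (c : ℕ) (_ : ∀ (M : ModuleCat.{u} R) (i : ℕ), c < i →
    CategoryTheory.Limits.IsZero ((localCohomology a i).obj M)), (c : ℕ∞)

/-- Two families of ideals indexed by `ℕ` are cofinal with each other if every member of either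
family contains a member of the other one. -/
def Ideal.AreCofinal {R : Type u} [CommRing R] (I J : ℕ → Ideal R) : Prop :=
  (∀ k, ∃ l, J l ≤ I k) ∧ (∀ k, ∃ l, I l ≤ J k)

/-!
Let `n` be the grade of `a`, attained by a regular sequence `rs` in `a`. The modules `R ⧸ I k`,
cofinal with the `R ⧸ a ^ k`, have projective dimension at most `n`, so local cohomology vanishes
above degree `n`. The transition maps between the modules `Ext (R ⧸ I k) R n` are injective, and
`Ext (R ⧸ I k) R n` is faithful over `R ⧸ I k`; hence the `n`-th local cohomology of `R` is nonzero.

It remains to see that `rs` generates an `𝔪`-primary ideal `X` in the localization `A` at a minimal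
prime of `a`. The socle of `D k = Ext (A ⧸ I k) A n` is the image of `Ext (A ⧸ 𝔪) A n`, so it has
`r` generators with `r` independent of `k`. An element `c` of a high power of `𝔪` annihilates the
`𝔪`-power torsion of `A ⧸ X`, hence the `X`-torsion of `D k`, which comes from
`Hom (A ⧸ (I k ⊔ X)) (A ⧸ X)`. Dually, `c` maps the Matlis dual of `D k`, a faithful
`A ⧸ I k`-module with `r` generators, into `X` times itself. By Cayley–Hamilton `c ^ r ∈ X ⊔ I k`
for all `k`, so `c ^ r ∈ X` by Krull's intersection theorem.
-/

section ExtWeaklyRegular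

open CategoryTheory Abelian RingTheory.Sequence

variable {S : Type u} [CommRing S] {T M : ModuleCat.{u} S} {rs : List S}

lemma annihilator_le_annihilator_ext (T M : ModuleCat.{u} S) (n : ℕ) :
    Module.annihilator S T ≤ Module.annihilator S (Ext T M n) := by
  intro c hc
  refine Module.mem_annihilator.mpr fun e => ?_
  have hzero : c • 𝟙 T = 0 := by
    ext t
    exact Module.mem_annihilator.mp hc t
  rw [← Ext.mk₀_id_comp e, ← Ext.smul_comp, ← Ext.mk₀_smul, hzero, Ext.mk₀_zero, Ext.zero_comp]

lemma comp_mk₀_smulShortComplex_f {n : ℕ} (x : S) (e : Ext T M n) :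
    e.comp (Ext.mk₀ (M.smulShortComplex x).f) (add_zero n) = x • e := by
  rw [Ext.smul_eq_comp_mk₀]
  congr 2

lemma subsingleton_of_isSMulRegular_of_mem_radical_annihilator {N : Type*} [AddCommGroup N]
    [Module S N] {x : S} (hx : IsSMulRegular N x) (hN : x ∈ (Module.annihilator S N).radical) :
    Subsingleton N := by
  obtain ⟨l, hl⟩ := hN
  refine subsingleton_of_forall_eq 0 fun y => hx.pow l ?_
  simpa using Module.mem_annihilator.mp hl y

lemma subsingleton_ext_of_isWeaklyRegular (hrs : IsWeaklyRegular M rs)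
    (hT : Ideal.ofList rs ≤ (Module.annihilator S T).radical) {i : ℕ} (hi : i < rs.length) :
    Subsingleton (Ext T M i) := by
  induction rs generalizing M i with
  | nil => simp at hi
  | cons x rs ih =>
    rw [isWeaklyRegular_cons_iff] at hrs
    rw [Ideal.ofList_cons, sup_le_iff, Ideal.span_singleton_le_iff_mem] at hT
    have hS := hrs.1.smulShortComplex_shortExact
    refine subsingleton_of_isSMulRegular_of_mem_radical_annihilator (x := x) ?_
      (Ideal.radical_mono (annihilator_le_annihilator_ext T M i) hT.1)
    refine .of_right_eq_zero_of_smul fun e he => ?_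
    rw [← comp_mk₀_smulShortComplex_f] at he
    cases i with
    | zero =>
      have := hS.mono_f
      exact Ext.postcomp_mk₀_injective_of_mono T (M.smulShortComplex x).f
        (he.trans (map_zero _).symm)
    | succ i =>
      obtain ⟨e₃, rfl⟩ := Ext.covariant_sequence_exact₁ T hS e he rfl
      have : Subsingleton (Ext T (M.smulShortComplex x).X₃ i) :=
        ih (M := ModuleCat.of S (QuotSMulTop x M)) hrs.2 hT.2 (by simpa using hi)
      rw [Subsingleton.elim e₃ 0]
      exact Ext.zero_comp ..

/-- Rees: `Ext T M rs.length` is a quotient of `Hom(T, M ⧸ rs M)`. -/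
lemma annihilator_linearMap_le_annihilator_ext (hrs : IsWeaklyRegular M rs)
    (hT : Ideal.ofList rs ≤ Module.annihilator S T) :
    Module.annihilator S (T →ₗ[S] (M ⧸ (Ideal.ofList rs • ⊤ : Submodule S M))) ≤
      Module.annihilator S (Ext T M rs.length) := by
  induction rs generalizing M with
  | nil =>
    let E : M ≃ₗ[S] (M ⧸ (Ideal.ofList ([] : List S) • ⊤ : Submodule S M)) :=
      (Submodule.quotEquivOfEqBot _ (by simp only [Ideal.ofList_nil, Submodule.bot_smul])).symm
    intro c hc
    refine Module.mem_annihilator.mpr fun e => ?_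
    obtain ⟨f, rfl⟩ := (Ext.mk₀_bijective T M).2 e
    have hf : c • f = 0 := by
      ext t
      apply E.injective
      simpa using LinearMap.congr_fun (Module.mem_annihilator.mp hc (E.toLinearMap ∘ₗ f.hom)) t
    rw [← Ext.mk₀_smul, hf, Ext.mk₀_zero]
  | cons x rs ih =>
    rw [isWeaklyRegular_cons_iff] at hrs
    rw [Ideal.ofList_cons, sup_le_iff, Ideal.span_singleton_le_iff_mem] at hT
    let E := LinearEquiv.congrRight (M := T)
      (Submodule.quotOfListConsSMulTopEquivQuotSMulTopInner M x rs)
    rw [E.annihilator_eq]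
    refine (ih (M := ModuleCat.of S (QuotSMulTop x M)) hrs.2 hT.2).trans fun c hc => ?_
    refine Module.mem_annihilator.mpr fun e => ?_
    have he := Module.mem_annihilator.mp (annihilator_le_annihilator_ext T M _ hT.1) e
    rw [← comp_mk₀_smulShortComplex_f] at he
    obtain ⟨e₃, rfl⟩ := Ext.covariant_sequence_exact₁ T hrs.1.smulShortComplex_shortExact e he
      (n₀ := rs.length) rfl
    have he₃ : c • e₃ = 0 := Module.mem_annihilator.mp hc e₃
    exact (Ext.smul_comp e₃ _ rfl c).symm.trans (by rw [he₃, Ext.zero_comp]; rfl)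

lemma ext_eq_zero_of_surjective_of_mk₀_comp_eq_zero (hrs : IsWeaklyRegular M rs) {X Y : Type u}
    [AddCommGroup X] [Module S X] [AddCommGroup Y] [Module S Y]
    (hX : Ideal.ofList rs ≤ (Module.annihilator S X).radical) {f : X →ₗ[S] Y}
    (hf : Function.Surjective f) (e : Ext (ModuleCat.of S Y) M rs.length)
    (he : (Ext.mk₀ (ModuleCat.ofHom f)).comp e (zero_add _) = 0) : e = 0 := by
  generalize hn : rs.length = n at e he
  cases n with
  | zero =>
    have : Epi (ModuleCat.ofHom f) := (ModuleCat.epi_iff_surjective _).mpr hf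
    exact Ext.precomp_mk₀_injective_of_epi M (ModuleCat.ofHom f) (he.trans (map_zero _).symm)
  | succ n =>
    obtain ⟨e₁, rfl⟩ := Ext.contravariant_sequence_exact₃ (LinearMap.shortExact_shortComplexKer hf)
      M e he (add_comm 1 n)
    have hker : Ideal.ofList rs ≤ (Module.annihilator S (LinearMap.ker f)).radical :=
      hX.trans (Ideal.radical_mono (LinearMap.annihilator_le_of_injective (LinearMap.ker f).subtype
        (LinearMap.ker f).subtype_injective))
    have he₁ : e₁ = 0 :=
      (subsingleton_ext_of_isWeaklyRegular (T := ModuleCat.of S (LinearMap.ker f)) hrs hker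
        (by omega)).elim e₁ 0
    rw [he₁]
    exact Ext.comp_zero ..

lemma ext_eq_zero_of_iSup_range_eq_top (hrs : IsWeaklyRegular M rs) {J : Type} [Finite J]
    {X Y : Type u} [AddCommGroup X] [Module S X] [AddCommGroup Y] [Module S Y]
    (hX : Ideal.ofList rs ≤ (Module.annihilator S X).radical) {f : J → X →ₗ[S] Y}
    (hf : ⨆ j, LinearMap.range (f j) = ⊤) (e : Ext (ModuleCat.of S Y) M rs.length)
    (he : ∀ j, (Ext.mk₀ (ModuleCat.ofHom (f j))).comp e (zero_add _) = 0) : e = 0 := by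
  classical
  have := Fintype.ofFinite J
  refine ext_eq_zero_of_surjective_of_mk₀_comp_eq_zero hrs (X := J → X)
    (f := LinearMap.lsum S (fun _ => X) S f) ?_ ?_ e ?_
  · refine hX.trans (Ideal.radical_mono fun c hc => ?_)
    exact Module.mem_annihilator.mpr fun t => funext fun j => Module.mem_annihilator.mp hc (t j)
  · rw [← LinearMap.range_eq_top, eq_top_iff, ← hf, iSup_le_iff]
    rintro j _ ⟨x, rfl⟩
    exact ⟨Pi.single j x, LinearMap.lsum_piSingle ..⟩
  · have hsum : ModuleCat.ofHom (LinearMap.lsum S (fun _ => X) S f) =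
        ∑ j, ModuleCat.ofHom (LinearMap.proj j) ≫ ModuleCat.ofHom (f j) := by
      ext x
      simp [ModuleCat.hom_sum, LinearMap.lsum_apply]
    rw [hsum, Ext.mk₀_sum, Ext.sum_comp]
    refine Finset.sum_eq_zero fun j _ => ?_
    rw [← Ext.mk₀_comp_mk₀_assoc, he j, Ext.comp_zero]

lemma exists_iSup_range_eq_top_of_ker_factor {I J : Ideal S} (hIJ : I ≤ J) (hJ : J.FG) :
    ∃ (n : ℕ) (g : Fin n → S) (f : Fin n → (S ⧸ I) →ₗ[S] LinearMap.ker (Submodule.factor hIJ)),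
      (∀ i, g i ∈ J) ∧ (∀ i, (LinearMap.ker (Submodule.factor hIJ)).subtype ∘ₗ f i =
        g i • LinearMap.id) ∧ ⨆ i, LinearMap.range (f i) = ⊤ := by
  obtain ⟨n, g, rfl⟩ := Submodule.fg_iff_exists_fin_generating_family.mp hJ
  set J : Ideal S := Submodule.span S (Set.range g)
  have hg : ∀ i, g i ∈ J := fun i => Submodule.subset_span ⟨i, rfl⟩
  let mulBy (i : Fin n) : (S ⧸ I) →ₗ[S] LinearMap.ker (Submodule.factor hIJ) :=
    (g i • LinearMap.id).codRestrict _ fun x => by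
      obtain ⟨y, rfl⟩ := Submodule.mkQ_surjective _ x
      change Submodule.factor hIJ (g i • Submodule.mkQ I y) = 0
      rw [← map_smul, Submodule.factor_mk, Submodule.mkQ_apply, Submodule.Quotient.mk_eq_zero]
      exact Ideal.mul_mem_right y J (hg i)
  refine ⟨n, g, mulBy, hg, fun i => rfl, eq_top_iff.mpr ?_⟩
  rintro ⟨x, hx⟩ -
  obtain ⟨y, rfl⟩ := Submodule.mkQ_surjective _ x
  have hy : y ∈ J := (Submodule.Quotient.mk_eq_zero J).mp hx
  have hJ : J ≤ ((⨆ i, LinearMap.range (mulBy i)).map (LinearMap.ker _).subtype).comap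
      (Submodule.mkQ I) := by
    refine Submodule.span_le.mpr ?_
    rintro _ ⟨i, rfl⟩
    refine ⟨mulBy i (Submodule.mkQ I 1), Submodule.mem_iSup_of_mem i ⟨_, rfl⟩, ?_⟩
    change g i • Submodule.mkQ I 1 = Submodule.mkQ I (g i)
    rw [← map_smul, smul_eq_mul, mul_one]
  obtain ⟨z, hz, hzy⟩ := hJ hy
  exact (Subtype.ext hzy : z = ⟨_, hx⟩) ▸ hz

lemma exists_mk₀_factor_comp_eq (hrs : IsWeaklyRegular M rs) {I J : Ideal S} (hIJ : I ≤ J)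
    (hJ : J.FG) (hI : Ideal.ofList rs ≤ I.radical)
    (d : Ext (ModuleCat.of S (S ⧸ I)) M rs.length) (hd : ∀ j ∈ J, j • d = 0) :
    ∃ d' : Ext (ModuleCat.of S (S ⧸ J)) M rs.length,
      (Ext.mk₀ (ModuleCat.ofHom (Submodule.factor hIJ))).comp d' (zero_add _) = d := by
  obtain ⟨n, g, f, hg, hf, htop⟩ := exists_iSup_range_eq_top_of_ker_factor hIJ hJ
  refine Ext.contravariant_sequence_exact₂
    (LinearMap.shortExact_shortComplexKer (Submodule.factor_surjective hIJ)) M d ?_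
  refine ext_eq_zero_of_iSup_range_eq_top hrs (by rwa [Ideal.annihilator_quotient]) htop _
    fun i => ?_
  have hcomp : ModuleCat.ofHom (f i) ≫
      ModuleCat.ofHom (LinearMap.ker (Submodule.factor hIJ)).subtype =
        g i • 𝟙 (ModuleCat.of S (S ⧸ I)) := congrArg ModuleCat.ofHom (hf i)
  refine (Ext.mk₀_comp_mk₀_assoc ..).trans ((congrArg (fun z => (Ext.mk₀ z).comp d
    (zero_add _)) hcomp).trans ?_)
  rw [Ext.mk₀_smul, Ext.smul_comp, Ext.mk₀_id_comp, hd _ (hg i)]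

end ExtWeaklyRegular

section BaseChange

open CategoryTheory Abelian RingTheory.Sequence TensorProduct

/-- `r` vanishes on `M` in the stable module category: multiplication by `r` on `M` factors through
a projective module. -/
def StablyAnnihilates {R : Type u} [CommRing R] (r : R) (M : Type u) [AddCommGroup M]
    [Module R M] : Prop :=
  ∃ (P : Type u) (_ : AddCommGroup P) (_ : Module R P) (_ : Module.Projective R P)
    (f : M →ₗ[R] P) (g : P →ₗ[R] M), g ∘ₗ f = r • LinearMap.id

namespace StablyAnnihilates

variable {R : Type u} [CommRing R] {r : R} {M F : Type u} [AddCommGroup M] [Module R M]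
  [AddCommGroup F] [Module R F]

lemma of_mem_annihilator (hr : r ∈ Module.annihilator R M) : StablyAnnihilates r M := by
  refine ⟨PUnit, inferInstance, inferInstance, inferInstance, 0, 0, ?_⟩
  ext x
  simpa using (Module.mem_annihilator.mp hr x).symm

lemma exists_comp_ker_subtype_eq (h : StablyAnnihilates r M) {π : F →ₗ[R] M}
    (hπ : Function.Surjective π) :
    ∃ t : F →ₗ[R] LinearMap.ker π, t ∘ₗ (LinearMap.ker π).subtype = r • LinearMap.id := by
  obtain ⟨P, _, _, _, f, g, hgf⟩ := h
  obtain ⟨s, hs⟩ := Module.projective_lifting_property π g hπ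
  have hker (x : F) : (r • LinearMap.id - s ∘ₗ f ∘ₗ π : F →ₗ[R] F) x ∈ LinearMap.ker π := by
    have hsf : π (s (f (π x))) = r • π x :=
      (LinearMap.congr_fun hs _).trans (LinearMap.congr_fun hgf _)
    simp [hsf]
  refine ⟨(r • LinearMap.id - s ∘ₗ f ∘ₗ π).codRestrict (LinearMap.ker π) hker, ?_⟩
  ext ⟨x, hx⟩
  simp [LinearMap.mem_ker.mp hx]

lemma ker [Module.Projective R F] (h : StablyAnnihilates r M) {π : F →ₗ[R] M}
    (hπ : Function.Surjective π) : StablyAnnihilates r (LinearMap.ker π) := by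
  obtain ⟨t, ht⟩ := h.exists_comp_ker_subtype_eq hπ
  exact ⟨F, inferInstance, inferInstance, inferInstance, _, t, ht⟩

lemma mem_annihilator_ker_baseChange (h : StablyAnnihilates r M) {π : F →ₗ[R] M}
    (hπ : Function.Surjective π) (S : Type u) [CommRing S] [Algebra R S] :
    algebraMap R S r ∈
      Module.annihilator S (LinearMap.ker ((LinearMap.ker π).subtype.baseChange S)) := by
  obtain ⟨t, ht⟩ := h.exists_comp_ker_subtype_eq hπ
  refine Module.mem_annihilator.mpr fun ⟨u, hu⟩ => Subtype.ext ?_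
  have hu' := LinearMap.congr_fun (congrArg (LinearMap.baseChange S) ht) u
  rw [LinearMap.baseChange_comp, LinearMap.comp_apply, LinearMap.mem_ker.mp hu, map_zero,
    LinearMap.baseChange_smul, LinearMap.baseChange_id] at hu'
  simpa [algebraMap_smul] using hu'.symm

end StablyAnnihilates

lemma isWeaklyRegular_of_flat {S P : Type*} [CommRing S] [AddCommGroup P] [Module S P]
    [Module.Flat S P] {rs : List S} (hrs : IsWeaklyRegular S rs) : IsWeaklyRegular P rs :=
  ((TensorProduct.rid S P).isWeaklyRegular_congr rs).mp (hrs.isWeaklyRegular_lTensor (M₂ := P))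

section

variable {S : Type u} [CommRing S] {T : ModuleCat.{u} S} {rs : List S}

lemma subsingleton_ext_of_hasProjectiveDimensionLE (hrs : IsWeaklyRegular S rs)
    (hT : Ideal.ofList rs ≤ (Module.annihilator S T).radical) {N : ModuleCat.{u} S} {n i : ℕ}
    (hN : HasProjectiveDimensionLE N n) (hi : n + i < rs.length) : Subsingleton (Ext T N i) := by
  induction n generalizing N i with
  | zero =>
    have : Module.Projective S N := (IsProjective.iff_projective N).mpr
      ((projective_iff_hasProjectiveDimensionLE_zero N).mpr hN)
    exact subsingleton_ext_of_isWeaklyRegular (isWeaklyRegular_of_flat hrs) hT (by omega)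
  | succ n ih =>
    have hP := N.shortExact_projectiveShortComplex
    have hproj : Projective N.projectiveShortComplex.X₂ := inferInstance
    have hK := (hP.hasProjectiveDimensionLT_X₃_iff n hproj).mp hN
    have h₁ := ih hK (i := i + 1) (by omega)
    have h₂ := ih (N := N.projectiveShortComplex.X₂) (i := i) inferInstance (by omega)
    refine subsingleton_of_forall_eq 0 fun e => ?_
    obtain ⟨e₂, rfl⟩ := Ext.covariant_sequence_exact₃ T hP e rfl (Subsingleton.elim _ _)
    rw [Subsingleton.elim e₂ 0, Ext.zero_comp]

lemma annihilator_ext_self_le_of_projective (T P : ModuleCat.{u} S) [Module.Finite S P]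
    [Module.Projective S P] (n : ℕ) :
    Module.annihilator S (Ext T (ModuleCat.of S S) n) ≤ Module.annihilator S (Ext T P n) := by
  intro c hc
  refine Module.mem_annihilator.mpr fun e => ?_
  obtain ⟨k, f, g, -, -, hfg⟩ := Module.Finite.exists_comp_eq_id_of_projective S P
  have hid : 𝟙 P = ∑ i : Fin k, (ModuleCat.ofHom (LinearMap.proj i ∘ₗ g) : P ⟶ ModuleCat.of S S) ≫
      ModuleCat.ofHom (f ∘ₗ LinearMap.single S (fun _ => S) i) := by
    ext x
    have hx : f (g x) = x := LinearMap.congr_fun hfg x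
    simp only [ModuleCat.hom_id, LinearMap.id_coe, id_eq, ModuleCat.hom_sum, ModuleCat.hom_comp,
      ModuleCat.hom_ofHom, LinearMap.sum_apply, LinearMap.comp_apply, LinearMap.proj_apply,
      LinearMap.single_apply]
    rw [← map_sum, Finset.univ_sum_single, hx]
  rw [← Ext.comp_mk₀_id e, hid, Ext.mk₀_sum, Ext.comp_sum, Finset.smul_sum]
  refine Finset.sum_eq_zero fun i _ => ?_
  rw [← Ext.mk₀_comp_mk₀, ← Ext.comp_assoc_of_second_deg_zero, ← Ext.smul_comp,
    Module.mem_annihilator.mp hc, Ext.zero_comp]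

lemma annihilator_ext_self_le_of_hasProjectiveDimensionLE [IsNoetherianRing S]
    (hrs : IsWeaklyRegular S rs) (hT : Ideal.ofList rs ≤ (Module.annihilator S T).radical)
    {N : ModuleCat.{u} S} [Module.Finite S N] {n j : ℕ} (hN : HasProjectiveDimensionLE N n)
    (hj : n + j = rs.length) :
    Module.annihilator S (Ext T (ModuleCat.of S S) rs.length) ≤
      Module.annihilator S (Ext T N j) := by
  induction n generalizing N j with
  | zero =>
    have : Module.Projective S N := (IsProjective.iff_projective N).mpr
      ((projective_iff_hasProjectiveDimensionLE_zero N).mpr hN)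
    obtain rfl : j = rs.length := by omega
    exact annihilator_ext_self_le_of_projective T N _
  | succ n ih =>
    obtain ⟨F, _, _, _, _, π, hπ⟩ := Module.exists_finite_presentation S N
    have hS := LinearMap.shortExact_shortComplexKer hπ
    have hK : HasProjectiveDimensionLE (ModuleCat.of S (LinearMap.ker π)) n :=
      (hS.hasProjectiveDimensionLT_X₃_iff n inferInstance).mp hN
    intro c hc
    have hc' := ih (N := ModuleCat.of S (LinearMap.ker π)) hK (j := j + 1) (by omega) hc
    refine Module.mem_annihilator.mpr fun e => ?_
    have he : (c • e).comp hS.extClass rfl = 0 :=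
      (Ext.smul_comp e hS.extClass rfl c).trans (Module.mem_annihilator.mp hc' _)
    obtain ⟨e₂, he₂⟩ := Ext.covariant_sequence_exact₃ T hS (c • e) rfl he
    have : Subsingleton (Ext T (ModuleCat.of S F) j) :=
      subsingleton_ext_of_isWeaklyRegular (isWeaklyRegular_of_flat hrs) hT (by omega)
    have he₂' : e₂ = 0 := this.elim e₂ 0
    rw [← he₂, he₂']
    exact Ext.zero_comp ..

lemma annihilator_ext_quotient_self_le [IsNoetherianRing S] (hrs : IsWeaklyRegular S rs)
    {I : Ideal S} (hI : Ideal.ofList rs ≤ I.radical)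
    (hpd : HasProjectiveDimensionLE (ModuleCat.of S (S ⧸ I)) rs.length) :
    Module.annihilator S (Ext (ModuleCat.of S (S ⧸ I)) (ModuleCat.of S S) rs.length) ≤ I := by
  intro c hc
  have hc' := annihilator_ext_self_le_of_hasProjectiveDimensionLE hrs
    (T := ModuleCat.of S (S ⧸ I)) (by rwa [Ideal.annihilator_quotient]) hpd (add_zero _) hc
  have hid := Module.mem_annihilator.mp hc' (Ext.mk₀ (𝟙 _))
  rw [← Ext.mk₀_smul, ← Ext.mk₀_zero, (Ext.mk₀_bijective _ _).1.eq_iff] at hid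
  have h1 : c • Submodule.mkQ I 1 = 0 := LinearMap.congr_fun (ModuleCat.hom_ext_iff.mp hid) _
  rwa [← map_smul, smul_eq_mul, mul_one, Submodule.mkQ_apply, Submodule.Quotient.mk_eq_zero] at h1

end

variable {R S : Type u} [CommRing R] [CommRing S] {a : Ideal R} {rs : List S} {n : ℕ}

lemma exact_baseChange_ker_subtype [Algebra R S] {M F : Type u} [AddCommGroup M] [Module R M]
    [AddCommGroup F] [Module R F] {π : F →ₗ[R] M} (hπ : Function.Surjective π) :
    Function.Exact ((LinearMap.ker π).subtype.baseChange S) (π.baseChange S) :=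
  lTensor_exact S (LinearMap.exact_subtype_ker_map π) hπ

lemma hasProjectiveDimensionLE_baseChange [Algebra R S] (hrs : IsWeaklyRegular S rs)
    (hmem : Ideal.ofList rs ≤ (a.map (algebraMap R S)).radical) (hn : n ≤ rs.length)
    {M : Type u} [AddCommGroup M] [Module R M]
    (hM : HasProjectiveDimensionLE (ModuleCat.of R M) n) (ha : ∀ r ∈ a, StablyAnnihilates r M) :
    HasProjectiveDimensionLE (ModuleCat.of S (S ⊗[R] M)) n := by
  induction n generalizing M with
  | zero =>
    have : Module.Projective R M := (IsProjective.iff_projective M).mpr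
      ((projective_iff_hasProjectiveDimensionLE_zero _).mpr hM)
    exact (projective_iff_hasProjectiveDimensionLE_zero _).mp
      ((IsProjective.iff_projective (S ⊗[R] M)).mp inferInstance)
  | succ n ih =>
    let π : (M →₀ R) →ₗ[R] M := Finsupp.linearCombination R id
    have hπ : Function.Surjective π := Finsupp.linearCombination_id_surjective R M
    have hS := LinearMap.shortExact_shortComplexKer hπ
    have hK : HasProjectiveDimensionLE (ModuleCat.of S (S ⊗[R] LinearMap.ker π)) n :=
      ih (by omega) ((hS.hasProjectiveDimensionLT_X₃_iff n inferInstance).mp hM)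
        fun r hr => (ha r hr).ker hπ
    set ι := (LinearMap.ker π).subtype.baseChange S
    have hker : Ideal.ofList rs ≤ (Module.annihilator S (LinearMap.ker ι)).radical :=
      hmem.trans (Ideal.radical_mono (Ideal.map_le_iff_le_comap.mpr fun r hr =>
        (ha r hr).mem_annihilator_ker_baseChange hπ S))
    have hι : Function.Injective ι := by
      have := subsingleton_ext_of_hasProjectiveDimensionLE (T := ModuleCat.of S (LinearMap.ker ι))
        hrs hker hK (i := 0) (by omega)
      have h0 : (ModuleCat.ofHom (LinearMap.ker ι).subtype :
          ModuleCat.of S (LinearMap.ker ι) ⟶ ModuleCat.of S (S ⊗[R] LinearMap.ker π)) = 0 :=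
        (Ext.mk₀_bijective _ _).1 (Subsingleton.elim _ _)
      rw [← LinearMap.ker_eq_bot, eq_bot_iff]
      exact fun x hx => LinearMap.congr_fun (ModuleCat.hom_ext_iff.mp h0) ⟨x, hx⟩
    have hex := exact_baseChange_ker_subtype (S := S) hπ
    have hS' : (ModuleCat.shortComplexOfCompEqZero ι (π.baseChange S)
        hex.linearMap_comp_eq_zero).ShortExact :=
      ModuleCat.shortComplex_shortExact _ hex hι (LinearMap.lTensor_surjective S hπ)
    exact (hS'.hasProjectiveDimensionLT_X₃_iff n
      ((IsProjective.iff_projective (S ⊗[R] (M →₀ R))).mp inferInstance)).mpr hK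

lemma hasProjectiveDimensionLE_quotient_map (ψ : R →+* S) (hrs : IsWeaklyRegular S rs)
    (hmem : Ideal.ofList rs ≤ (a.map ψ).radical) (hn : n ≤ rs.length)
    (hpd : HasProjectiveDimensionLE (ModuleCat.of R (R ⧸ a)) n) :
    HasProjectiveDimensionLE (ModuleCat.of S (S ⧸ a.map ψ)) n := by
  let := ψ.toAlgebra
  have := hasProjectiveDimensionLE_baseChange hrs hmem hn hpd fun r hr =>
    .of_mem_annihilator (by rwa [Ideal.annihilator_quotient])
  exact hasProjectiveDimensionLT_of_iso
    (Algebra.TensorProduct.quotIdealMapEquivTensorQuot S a).toLinearEquiv.toModuleIso.symm _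

end BaseChange

section DerivedExt

open CategoryTheory Limits Opposite HomologicalComplex

variable {R : Type u} [CommRing R]

lemma homologyπ_cyclesMk_eq_zero_iff {ι : Type*} {c : ComplexShape ι}
    (K : HomologicalComplex (ModuleCat.{u} R) c) {i j : ι} (hj : c.next i = j) (x : K.X i)
    (hx : K.d i j x = 0) :
    K.homologyπ i (K.cyclesMk x j hj hx) = 0 ↔ ∃ y, K.d (c.prev i) i y = x := by
  have hi : K.iCycles i (K.cyclesMk x j hj hx) = x := K.i_cyclesMk x j hj hx
  have hd (y) : K.iCycles i (K.toCycles (c.prev i) i y) = K.d (c.prev i) i y :=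
    ConcreteCategory.congr_hom (K.toCycles_i (c.prev i) i) y
  have hex := (ShortComplex.moduleCat_exact_iff _).mp <| ShortComplex.exact_of_g_is_cokernel
    (.mk (K.toCycles _ i) (K.homologyπ i) (K.toCycles_comp_homologyπ _ i))
    (K.homologyIsCokernel _ i rfl)
  constructor
  · intro h
    obtain ⟨y, hy⟩ := hex _ h
    exact ⟨y, by rw [← hd, ← hi]; exact congrArg _ hy⟩
  · rintro ⟨y, hy⟩
    have hy' : K.toCycles _ i y = K.cyclesMk x j hj hx :=
      (ModuleCat.mono_iff_injective _).mp inferInstance (by rw [hd, hi, hy])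
    rw [← hy']
    exact ConcreteCategory.congr_hom (K.toCycles_comp_homologyπ (c.prev i) i) y

variable {X Y : ModuleCat.{u} R} {n : ℕ}

/-- The class in the derived functor `Ext R (ModuleCat R) n` of a cocycle on a projective
resolution, the counterpart of `CategoryTheory.ProjectiveResolution.extMk`. Local cohomology is
defined by the former, long exact sequences are available for the latter. -/
noncomputable def derivedExtMk (P : ProjectiveResolution X) (f : P.complex.X n ⟶ Y)
    (hf : P.complex.d (n + 1) n ≫ f = 0) : ((Ext R (ModuleCat.{u} R) n).obj (op X)).obj Y :=
  (P.isoExt n Y).inv ((P.complex.linearYonedaObj R Y).homologyπ n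
    ((P.complex.linearYonedaObj R Y).cyclesMk f (n + 1) (CochainComplex.next ℕ n) hf))

lemma derivedExtMk_surjective (P : ProjectiveResolution X)
    (z : ((Ext R (ModuleCat.{u} R) n).obj (op X)).obj Y) :
    ∃ (f : P.complex.X n ⟶ Y) (hf : P.complex.d (n + 1) n ≫ f = 0), derivedExtMk P f hf = z := by
  set K := P.complex.linearYonedaObj R Y
  obtain ⟨y, rfl⟩ := (ConcreteCategory.bijective_of_isIso (P.isoExt (R := R) n Y).inv).2 z
  obtain ⟨x, rfl⟩ := (ModuleCat.epi_iff_surjective (K.homologyπ n)).mp inferInstance y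
  have hx : K.d n (n + 1) (K.iCycles n x) = 0 :=
    ConcreteCategory.congr_hom (K.iCycles_d n (n + 1)) x
  refine ⟨K.iCycles n x, hx, ?_⟩
  have hcycle : K.cyclesMk (K.iCycles n x) (n + 1) (CochainComplex.next ℕ n) hx = x :=
    (ModuleCat.mono_iff_injective (K.iCycles n)).mp inferInstance (K.i_cyclesMk ..)
  exact congrArg (fun x => (P.isoExt n Y).inv (K.homologyπ n x)) hcycle

lemma derivedExtMk_eq_zero_iff (P : ProjectiveResolution X) (f : P.complex.X n ⟶ Y)
    (hf : P.complex.d (n + 1) n ≫ f = 0) :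
    derivedExtMk P f hf = 0 ↔ ∃ y, P.complex.d n ((ComplexShape.up ℕ).prev n) ≫ y = f := by
  rw [derivedExtMk, map_eq_zero_iff _ (ConcreteCategory.bijective_of_isIso (P.isoExt n Y).inv).1]
  exact homologyπ_cyclesMk_eq_zero_iff (P.complex.linearYonedaObj R Y) ..

lemma extMk_eq_zero_of_derivedExtMk_eq_zero (P : ProjectiveResolution X) (f : P.complex.X n ⟶ Y)
    (hf : P.complex.d (n + 1) n ≫ f = 0) (h : derivedExtMk P f hf = 0) :
    P.extMk f (n + 1) rfl hf = 0 := by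
  obtain ⟨y, hy⟩ := (derivedExtMk_eq_zero_iff P f hf).mp h
  cases n with
  | zero =>
    obtain rfl : f = 0 := by rw [← hy, P.complex.shape _ _ (by simp), zero_comp]
    exact P.extMk_zero ..
  | succ n => exact (P.extMk_eq_zero_iff f _ rfl hf _ (by simp)).mpr ⟨y, hy⟩

lemma map_derivedExtMk {X' : ModuleCat.{u} R} {P : ProjectiveResolution X}
    {P' : ProjectiveResolution X'} {g : X ⟶ X'} (φ : ProjectiveResolution.Hom P P' g)
    (f : P'.complex.X n ⟶ Y) (hf : P'.complex.d (n + 1) n ≫ f = 0) :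
    ((Ext R (ModuleCat.{u} R) n).map g.op).app Y (derivedExtMk P' f hf) =
      derivedExtMk P (φ.hom.f n ≫ f)
        (by rw [← φ.hom.comm_assoc, hf, comp_zero]) := by
  let ψ : P'.complex.linearYonedaObj R Y ⟶ P.complex.linearYonedaObj R Y :=
    (unopFunctor _ _).map
      ((((linearYoneda R (ModuleCat.{u} R)).obj Y).rightOp.mapHomologicalComplex _).map φ.hom).op
  have hiso : (P'.isoExt n Y).inv ≫ ((Ext R (ModuleCat.{u} R) n).map g.op).app Y =
      homologyMap ψ n ≫ (P.isoExt n Y).inv := by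
    have hderived := P.isoLeftDerivedObj_hom_naturality g P' φ.hom φ.hom_f_zero_comp_π_f_zero
      ((linearYoneda R (ModuleCat.{u} R)).obj Y).rightOp n
    exact Quiver.Hom.op_inj
      ((CommSq.mk hderived).vert_comp (CommSq.mk (homologyOp_hom_naturality ψ n))).w
  rw [derivedExtMk, derivedExtMk, ← ConcreteCategory.comp_apply, hiso, ConcreteCategory.comp_apply,
    ← ConcreteCategory.comp_apply (homologyπ _ n), homologyπ_naturality,
    ConcreteCategory.comp_apply]
  refine congrArg (fun z => (P.isoExt n Y).inv ((P.complex.linearYonedaObj R Y).homologyπ n z)) ?_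
  refine (ModuleCat.mono_iff_injective ((P.complex.linearYonedaObj R Y).iCycles n)).mp
    inferInstance ?_
  refine (ConcreteCategory.congr_hom (cyclesMap_i ψ n) _).trans ?_
  refine (congrArg (ψ.f n) ((P'.complex.linearYonedaObj R Y).i_cyclesMk ..)).trans ?_
  exact ((P.complex.linearYonedaObj R Y).i_cyclesMk ..).symm

end DerivedExt

section LocalCohomology

open CategoryTheory Limits Opposite RingTheory.Sequence

variable {R : Type u} [CommRing R]

lemma exists_derivedExt_representative {X' Y : ModuleCat.{u} R} {n : ℕ}
    (e : Abelian.Ext X' Y n) :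
    ∃ z : ((Ext R (ModuleCat.{u} R) n).obj (op X')).obj Y, ∀ {X : ModuleCat.{u} R} (g : X ⟶ X'),
      ((Ext R (ModuleCat.{u} R) n).map g.op).app Y z = 0 →
        (Abelian.Ext.mk₀ g).comp e (zero_add n) = 0 := by
  let P' := projectiveResolution X'
  obtain ⟨f, hf, rfl⟩ := P'.extMk_surjective e (n + 1) rfl
  refine ⟨derivedExtMk P' f hf, fun {X} g hg => ?_⟩
  let P := projectiveResolution X
  let φ : ProjectiveResolution.Hom P P' g :=
    ⟨ProjectiveResolution.lift g P P', by
      simpa using ProjectiveResolution.lift_commutes_zero g P P'⟩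
  rw [ProjectiveResolution.mk₀_comp_extMk f (n + 1) rfl hf φ]
  exact extMk_eq_zero_of_derivedExtMk_eq_zero P _ _ (by rwa [map_derivedExtMk φ] at hg)

lemma isZero_derivedExt_of_subsingleton {X Y : ModuleCat.{u} R} {n : ℕ}
    [Subsingleton (Abelian.Ext X Y (n + 1))] :
    IsZero (((Ext R (ModuleCat.{u} R) (n + 1)).obj (op X)).obj Y) := by
  let P := projectiveResolution X
  rw [ModuleCat.isZero_iff_subsingleton]
  refine subsingleton_of_forall_eq 0 fun z => ?_
  obtain ⟨f, hf, rfl⟩ := derivedExtMk_surjective P z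
  obtain ⟨y, hy⟩ := (P.extMk_eq_zero_iff f (n + 2) rfl hf n rfl).mp (Subsingleton.elim _ _)
  exact (derivedExtMk_eq_zero_iff P f hf).mpr
    (by rw [CochainComplex.prev_nat_succ]; exact ⟨y, hy⟩)

variable {a : Ideal R} {M : ModuleCat.{u} R} {i : ℕ}

lemma isZero_localCohomology_of_map_factor_eq_zero
    (h : ∀ k : ℕ, ∃ (l : ℕ) (hkl : k ≤ l),
      ((Ext R (ModuleCat.{u} R) i).map (ModuleCat.ofHom (Submodule.factor
        (Ideal.pow_le_pow_right hkl : a ^ l ≤ a ^ k))).op).app M = 0) :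
    IsZero ((localCohomology a i).obj M) := by
  let F := localCohomology.diagram (localCohomology.idealPowersDiagram a) i
  refine IsZero.of_iso ?_ (colimitObjIsoColimitCompEvaluation F M)
  rw [IsZero.iff_id_eq_zero]
  refine colimit.hom_ext fun k => ?_
  obtain ⟨l, hkl, hl⟩ := h k.unop.unop
  let f : k ⟶ op (op l) := (homOfLE hkl).op.op
  have hzero : (F ⋙ (evaluation _ _).obj M).map f = 0 := hl
  rw [← colimit.w _ f, hzero, zero_comp, zero_comp, comp_zero]

lemma exists_mk₀_factor_comp_eq_zero_of_isZero_localCohomology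
    (h : IsZero ((localCohomology a i).obj M)) {k : ℕ}
    (e : Abelian.Ext (ModuleCat.of R (R ⧸ a ^ k)) M i) :
    ∃ (l : ℕ) (hkl : k ≤ l), (Abelian.Ext.mk₀ (ModuleCat.ofHom (Submodule.factor
        (Ideal.pow_le_pow_right hkl : a ^ l ≤ a ^ k)))).comp e (zero_add i) = 0 := by
  obtain ⟨z, hz⟩ := exists_derivedExt_representative e
  let F := localCohomology.diagram (localCohomology.idealPowersDiagram a) i
  have h0 : IsZero (colimit (F ⋙ (evaluation _ _).obj M)) :=
    h.of_iso (colimitObjIsoColimitCompEvaluation F M).symm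
  have : PreservesFilteredColimitsOfSize.{0, 0} (forget (ModuleCat.{u} R)) :=
    preservesFilteredColimitsOfSize_shrink.{0, u, 0, u} _
  obtain ⟨l, f, hf⟩ := Concrete.colimit_rep_eq_zero R (F ⋙ (evaluation _ _).obj M) (op (op k)) z
    (by rw [h0.eq_of_tgt (colimit.ι (F ⋙ (evaluation _ _).obj M) (op (op k))) 0]; rfl)
  exact ⟨l.unop.unop, f.unop.unop.down.down, hz _ hf⟩

lemma isZero_localCohomology_of_hasProjectiveDimensionLE {I : ℕ → Ideal R}
    (hI : Ideal.AreCofinal I (fun k => a ^ k)) {n : ℕ}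
    (hpd : ∀ k, HasProjectiveDimensionLE (ModuleCat.of R (R ⧸ I k)) n) (hi : n < i) :
    IsZero ((localCohomology a i).obj M) := by
  obtain ⟨i, rfl⟩ := Nat.exists_eq_add_one_of_ne_zero (Nat.ne_zero_of_lt hi)
  refine isZero_localCohomology_of_map_factor_eq_zero fun k => ?_
  obtain ⟨j, hj⟩ := hI.2 k
  obtain ⟨l, hl⟩ := hI.1 j
  refine ⟨max l k, le_max_right l k, ?_⟩
  have hlj : a ^ max l k ≤ I j := (Ideal.pow_le_pow_right (le_max_left l k)).trans hl
  have hfactor : ModuleCat.ofHom (Submodule.factor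
      (Ideal.pow_le_pow_right (le_max_right l k) : a ^ max l k ≤ a ^ k)) =
      ModuleCat.ofHom (Submodule.factor hlj) ≫ ModuleCat.ofHom (Submodule.factor hj) := by
    rw [← ModuleCat.ofHom_comp, Submodule.factor_comp]
  have := hpd j
  have : Subsingleton (Abelian.Ext (ModuleCat.of R (R ⧸ I j)) M (i + 1)) :=
    HasProjectiveDimensionLT.subsingleton _ (n + 1) _ (by omega) M
  rw [hfactor, op_comp, Functor.map_comp, NatTrans.comp_app,
    isZero_derivedExt_of_subsingleton.eq_of_tgt (((Ext R (ModuleCat.{u} R) (i + 1)).map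
      (ModuleCat.ofHom (Submodule.factor hj)).op).app M) 0, zero_comp]

lemma not_isZero_localCohomology_of_ext_ne_zero {rs : List R} (hrs : IsWeaklyRegular M rs)
    (hmem : Ideal.ofList rs ≤ a) {I : Ideal R} {k : ℕ} (hI : a ^ k ≤ I)
    {e : Abelian.Ext (ModuleCat.of R (R ⧸ I)) M rs.length} (he : e ≠ 0) :
    ¬IsZero ((localCohomology a rs.length).obj M) := by
  have hrad (l : ℕ) : Ideal.ofList rs ≤ (Module.annihilator R (R ⧸ a ^ l)).radical := by
    rw [Ideal.annihilator_quotient]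
    exact fun x hx => ⟨l, Ideal.pow_mem_pow (hmem hx) l⟩
  intro h
  obtain ⟨l, hl, hel⟩ := exists_mk₀_factor_comp_eq_zero_of_isZero_localCohomology h
    ((Abelian.Ext.mk₀ (ModuleCat.ofHom (Submodule.factor hI))).comp e (zero_add _))
  exact he <| ext_eq_zero_of_surjective_of_mk₀_comp_eq_zero hrs (hrad k)
    (Submodule.factor_surjective hI) e <|
      ext_eq_zero_of_surjective_of_mk₀_comp_eq_zero hrs (hrad l)
        (Submodule.factor_surjective (Ideal.pow_le_pow_right hl)) _ hel

end LocalCohomology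

section InjectiveHull

open CategoryTheory

/-- In a lattice of submodules: `E` is an essential extension of `K`. -/
def IsEssentialExtension {α : Type*} [PartialOrder α] [OrderBot α] (K E : α) : Prop :=
  K ≤ E ∧ ∀ N ≤ E, Disjoint N K → N = ⊥

lemma exists_maximal_isEssentialExtension {α : Type*} [CompleteLattice α]
    [IsCompactlyGenerated α] (K : α) : ∃ E, Maximal (IsEssentialExtension K) E := by
  suffices ∃ E, K ≤ E ∧ Maximal (IsEssentialExtension K) E from this.imp fun E hE => hE.2
  refine zorn_le_nonempty₀ {E : α | IsEssentialExtension K E} (fun c hc hchain E hE => ?_) K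
    ⟨le_rfl, fun N hN hNK => hNK.eq_bot_of_le hN⟩
  refine ⟨sSup c, ⟨(hc hE).1.trans (le_sSup hE), fun N hN hNK => ?_⟩, fun F hF => le_sSup hF⟩
  refine Disjoint.eq_bot_of_le (hchain.directedOn.disjoint_sSup_right.mpr fun F hF => ?_) hN
  exact disjoint_iff.mpr ((hc hF).2 _ inf_le_right (hNK.mono_left inf_le_left))

lemma exists_maximal_disjoint {α : Type*} [CompleteLattice α] [IsCompactlyGenerated α] (E : α) :
    ∃ U, Maximal (Disjoint · E) U := by
  obtain ⟨U, -, hU⟩ := zorn_le_nonempty₀ {U : α | Disjoint U E} (fun c hc hchain U _ =>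
    ⟨sSup c, hchain.directedOn.disjoint_sSup_left.mpr hc, fun V hV => le_sSup hV⟩) ⊥
    disjoint_bot_left
  exact ⟨U, hU⟩

variable {A : Type u} [CommRing A]

lemma exists_comp_eq_of_ker_le_ker {E : Type u} {P P' : Type*} [AddCommGroup E] [Module A E]
    [Module.Injective A E] [AddCommGroup P] [Module A P] [AddCommGroup P'] [Module A P']
    (i : P →ₗ[A] P') (f : P →ₗ[A] E) (h : LinearMap.ker i ≤ LinearMap.ker f) :
    ∃ g : P' →ₗ[A] E, g ∘ₗ i = f := by
  obtain ⟨g, hg⟩ := Module.Injective.extension_property A E _ P'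
    ((LinearMap.ker i).liftQ i le_rfl)
    (LinearMap.ker_eq_bot.mp (Submodule.ker_liftQ_eq_bot _ _ _ le_rfl))
    ((LinearMap.ker i).liftQ f h)
  exact ⟨g, by rw [← Submodule.liftQ_mkQ _ i le_rfl, ← LinearMap.comp_assoc, hg,
    Submodule.liftQ_mkQ]⟩

lemma injective_of_leftInverse {E Q : Type u} [AddCommGroup E] [Module A E] [AddCommGroup Q]
    [Module A Q] [Module.Injective A Q] (i : E →ₗ[A] Q) (p : Q →ₗ[A] E)
    (h : Function.LeftInverse p i) : Module.Injective A E where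
  out X Y _ _ _ _ f hf g := by
    obtain ⟨t, ht⟩ := Module.Injective.out f hf (i ∘ₗ g)
    exact ⟨p ∘ₗ t, fun x => by rw [LinearMap.comp_apply, ht, LinearMap.comp_apply, h]⟩

variable {Q : Type u} [AddCommGroup Q] [Module A Q]

lemma isEssentialExtension_range {K E : Submodule A Q} (hKE : IsEssentialExtension K E)
    {p : Q →ₗ[A] Q} (hp : ∀ x ∈ E, p x = x) (hker : Maximal (Disjoint · E) (LinearMap.ker p)) :
    IsEssentialExtension K (LinearMap.range p) := by
  refine ⟨fun x hx => ⟨x, hp x (hKE.1 hx)⟩, fun N hN hNK => ?_⟩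
  have hNE : N ⊓ E = ⊥ := hKE.2 _ inf_le_right (hNK.mono_left inf_le_left)
  have hdisj : Disjoint (N.comap p) E := by
    refine disjoint_iff.mpr (eq_bot_iff.mpr fun x hx => hNE ▸ ⟨?_, hx.2⟩)
    rw [← hp x hx.2]
    exact hx.1
  have hle : N.comap p ≤ LinearMap.ker p := hker.le_of_ge hdisj (LinearMap.ker_le_comap p)
  rwa [← Submodule.map_comap_eq_of_le hN, ← LinearMap.le_ker_iff_map]

lemma exists_injective_isEssentialExtension [Module.Injective A Q] (K : Submodule A Q) :
    ∃ E : Submodule A Q, Module.Injective A E ∧ IsEssentialExtension K E := by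
  obtain ⟨E, hE⟩ := exists_maximal_isEssentialExtension K
  obtain ⟨U, hU⟩ := exists_maximal_disjoint E
  have hEU : LinearMap.ker (U.mkQ ∘ₗ E.subtype) = ⊥ := by
    rw [LinearMap.ker_comp, Submodule.ker_mkQ, ← Submodule.disjoint_iff_comap_eq_bot]
    exact hU.prop.symm
  obtain ⟨t, ht⟩ := exists_comp_eq_of_ker_le_ker (U.mkQ ∘ₗ E.subtype) E.subtype (by simp [hEU])
  let p : Q →ₗ[A] Q := t ∘ₗ U.mkQ
  have hp (x) (hx : x ∈ E) : p x = x := LinearMap.congr_fun ht ⟨x, hx⟩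
  have hUp : U ≤ LinearMap.ker p := by
    simpa only [p, LinearMap.ker_comp, U.ker_mkQ] using LinearMap.ker_le_comap U.mkQ
  have hker : LinearMap.ker p = U := by
    refine (hU.eq_of_le (Submodule.disjoint_def.mpr fun x hx hxE => ?_) hUp).symm
    rw [← hp x hxE, LinearMap.mem_ker.mp hx]
  have hrange : LinearMap.range p = E :=
    (hE.eq_of_le (isEssentialExtension_range hE.prop hp (hker ▸ hU))
      fun x hx => ⟨x, hp x hx⟩).symm
  refine ⟨E, injective_of_leftInverse E.subtype (p.codRestrict E fun x => hrange ▸ ⟨x, rfl⟩)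
    fun x => Subtype.ext (hp x x.2), hE.prop⟩

lemma inf_torsionBySet_le_of_isEssentialExtension {K E : Submodule A Q}
    (hKE : IsEssentialExtension K E) (m : Ideal A) [hm : m.IsMaximal] :
    E ⊓ Submodule.torsionBySet A Q m ≤ K := by
  rintro e ⟨he, hme⟩
  rw [SetLike.mem_coe, Submodule.mem_torsionBySet_iff] at hme
  by_cases h0 : e = 0
  · exact h0 ▸ K.zero_mem
  have hnd : ¬Disjoint (A ∙ e) K := fun hd => h0 <| Submodule.span_singleton_eq_bot.mp <|
    hKE.2 _ ((Submodule.span_singleton_le_iff_mem _ _).mpr he) hd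
  simp only [Submodule.disjoint_def, not_forall] at hnd
  obtain ⟨_, hx, hxK, hx0⟩ := hnd
  obtain ⟨a, rfl⟩ := Submodule.mem_span_singleton.mp hx
  obtain ⟨y, z, hz, hyz⟩ := hm.exists_inv fun ha => hx0 (hme ⟨a, ha⟩)
  have hye : y • a • e = e := by
    rw [← mul_smul, eq_sub_of_add_eq hyz, sub_smul, hme ⟨z, hz⟩, one_smul, sub_zero]
  exact hye ▸ K.smul_mem y hxK

theorem exists_injective_torsionBySet_eq_span_singleton (m : Ideal A) [hm : m.IsMaximal] :
    ∃ (E : Type u) (_ : AddCommGroup E) (_ : Module A E) (ε : E), Module.Injective A E ∧ ε ≠ 0 ∧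
      Submodule.torsionBySet A E m = A ∙ ε := by
  let k := ModuleCat.of A (A ⧸ m)
  let Q : ModuleCat A := Injective.under k
  let i : (A ⧸ m) →ₗ[A] Q := (Injective.ι k).hom
  have hi : Function.Injective i := (ModuleCat.mono_iff_injective _).mp inferInstance
  have : Injective (ModuleCat.of A Q) := Injective.injective_under k
  have := Module.injective_module_of_injective_object A Q
  obtain ⟨E, hE, hess⟩ := exists_injective_isEssentialExtension (LinearMap.range i)
  have hsmul (a : A) : i (Ideal.Quotient.mk m a) = a • i 1 := by
    rw [← map_smul, Algebra.smul_def, mul_one, Ideal.Quotient.algebraMap_eq]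
  refine ⟨E, inferInstance, inferInstance, ⟨i 1, hess.1 ⟨1, rfl⟩⟩, hE, fun h => ?_, ?_⟩
  · have : Nontrivial (A ⧸ m) := Ideal.Quotient.nontrivial_iff.mpr hm.ne_top
    exact one_ne_zero (hi ((congrArg Subtype.val h).trans (map_zero i).symm))
  refine le_antisymm (fun e he => ?_) ((Submodule.span_singleton_le_iff_mem _ _).mpr ?_)
  · rw [Submodule.mem_torsionBySet_iff] at he
    obtain ⟨y, hy⟩ := inf_torsionBySet_le_of_isEssentialExtension hess m ⟨e.2,
      (Submodule.mem_torsionBySet_iff _ _).mpr fun a => congrArg Subtype.val (he a)⟩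
    obtain ⟨a, rfl⟩ := Ideal.Quotient.mk_surjective y
    exact Submodule.mem_span_singleton.mpr ⟨a, Subtype.ext ((hsmul a).symm.trans hy)⟩
  · refine (Submodule.mem_torsionBySet_iff _ _).mpr fun a => Subtype.ext ?_
    exact (hsmul a).symm.trans
      ((congrArg i (Ideal.Quotient.eq_zero_iff_mem.mpr a.2)).trans (map_zero i))

end InjectiveHull

section MatlisDual

variable {A : Type u} [CommRing A]

lemma pow_spanFinrank_mem_sup_annihilator {N : Type*} [AddCommGroup N] [Module A N]
    [Module.Finite A N] {X : Ideal A} {c : A} (hc : ∀ f : N, c • f ∈ (X • ⊤ : Submodule A N)) :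
    c ^ (⊤ : Submodule A N).spanFinrank ∈ X ⊔ Module.annihilator A N := by
  obtain ⟨p, hp, hdeg, hcoeff, hp0⟩ :=
    LinearMap.exists_monic_and_natDegree_eq_and_coeff_mem_pow_and_aeval_eq_zero A
      (algebraMap A (Module.End A N) c) X (by rintro _ ⟨f, rfl⟩; exact hc f)
  have hpc : p.eval c ∈ Module.annihilator A N := by
    rw [Polynomial.aeval_algebraMap_apply, Polynomial.coe_aeval_eq_eval] at hp0
    exact Module.mem_annihilator.mpr (LinearMap.congr_fun hp0)
  rw [Polynomial.eval_eq_sum_range, Finset.sum_range_succ, hp.coeff_natDegree, one_mul] at hpc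
  have hsum : ∑ i ∈ Finset.range p.natDegree, p.coeff i * c ^ i ∈ X := by
    refine Ideal.sum_mem _ fun i hi => Ideal.mul_mem_right _ _ ?_
    exact Ideal.pow_le_self (Nat.sub_ne_zero_of_lt (Finset.mem_range.mp hi)) (hcoeff i)
  rw [← hdeg]
  exact (Submodule.add_mem_iff_right _ (Ideal.mem_sup_left hsum)).mp (Ideal.mem_sup_right hpc)

lemma exists_finite_span_sup_ker_eq_top {K N V : Type*} [Field K] [Algebra A K]
    (hK : Function.Surjective (algebraMap A K)) [AddCommGroup N] [Module A N] [AddCommGroup V]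
    [Module A V] [Module K V] [IsScalarTower A K V] [Module.Finite K V] (ρ : N →ₗ[A] V) :
    ∃ s : Set N, s.Finite ∧ s.ncard ≤ Module.finrank K V ∧
      Submodule.span A s ⊔ LinearMap.ker ρ = ⊤ := by
  obtain ⟨t, htρ, hcard, hspan, -⟩ :=
    Submodule.exists_finset_span_eq_linearIndepOn K (Set.range ρ)
  have hsurj : Set.SurjOn ρ Set.univ t := by rwa [Set.SurjOn, Set.image_univ]
  obtain ⟨s, -, hs⟩ := hsurj.exists_bijOn_subset
  refine ⟨s, hs.finite_iff_finite.mpr t.finite_toSet, ?_, ?_⟩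
  · rw [hs.ncard_eq, Set.ncard_coe_finset, hcard]
    exact Submodule.finrank_le _
  · rw [← Submodule.comap_map_eq, Submodule.map_span, hs.image_eq, eq_top_iff]
    intro f _
    rw [Submodule.mem_comap, ← Submodule.restrictScalars_span A K hK, hspan]
    exact Submodule.subset_span ⟨f, rfl⟩

lemma eq_top_of_sup_smul_eq_top {N : Type*} [AddCommGroup N] [Module A N] {m : Ideal A}
    {n : ℕ} (hn : m ^ n ≤ Module.annihilator A N) {P : Submodule A N}
    (hP : P ⊔ m • ⊤ = ⊤) : P = ⊤ := by
  have hpow (k : ℕ) : P ⊔ m ^ k • ⊤ = ⊤ := by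
    induction k with
    | zero => simp
    | succ k ih =>
      refine top_le_iff.mp (ih.symm.le.trans (sup_le le_sup_left ?_))
      nth_rw 1 [← hP, Submodule.smul_sup, pow_succ, Submodule.mul_smul]
      exact sup_le_sup_right Submodule.smul_le_right _
  have hzero : m ^ n • (⊤ : Submodule A N) = ⊥ :=
    eq_bot_iff.mpr <| (Submodule.smul_mono_left hn).trans_eq <| by
      rw [← Submodule.annihilator_top, Submodule.annihilator_smul]
  rw [← hpow n, hzero, sup_bot_eq]

variable {D E : Type u} [AddCommGroup D] [Module A D] [AddCommGroup E] [Module A E]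
  [Module.Injective A E]

lemma annihilator_le_annihilator_linearMap (D E : Type*) [AddCommGroup D] [Module A D]
    [AddCommGroup E] [Module A E] :
    Module.annihilator A D ≤ Module.annihilator A (D →ₗ[A] E) := fun a ha => by
  rw [Module.mem_annihilator] at ha ⊢
  exact fun f => LinearMap.ext fun d => by
    rw [LinearMap.smul_apply, ← map_smul, ha, map_zero, LinearMap.zero_apply]

lemma mem_smul_top_of_torsionBySet_le_ker {J : Ideal A} (hJ : J.FG) {f : D →ₗ[A] E}
    (hf : Submodule.torsionBySet A D J ≤ LinearMap.ker f) :
    f ∈ J • (⊤ : Submodule A (D →ₗ[A] E)) := by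
  classical
  obtain ⟨s, rfl⟩ := hJ
  let μ : D →ₗ[A] (s → D) := LinearMap.pi fun j => (j : A) • LinearMap.id
  have hμ : LinearMap.ker μ ≤ LinearMap.ker f := fun d hd => hf <| by
    rw [← Submodule.torsionBySet_eq_torsionBySet_span, Submodule.mem_torsionBySet_iff]
    exact congrFun (LinearMap.mem_ker.mp hd)
  obtain ⟨g, hg⟩ := exists_comp_eq_of_ker_le_ker μ f hμ
  have hfg : f = ∑ j : s, (j : A) • (g ∘ₗ LinearMap.single A (fun _ => D) j) := by
    ext d
    rw [← hg, LinearMap.comp_apply, ← Finset.univ_sum_single (μ d), map_sum, LinearMap.sum_apply]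
    refine Finset.sum_congr rfl fun j _ => ?_
    rw [LinearMap.smul_apply, ← map_smul]
    rfl
  rw [hfg]
  exact Submodule.sum_mem _ fun j _ =>
    Submodule.smul_mem_smul (Ideal.subset_span j.2) Submodule.mem_top

variable {m : Ideal A} {ε : E}

lemma finite_dual_and_spanFinrank_le [hm : m.IsMaximal] (hfg : m.FG)
    (hε : Submodule.torsionBySet A E m = A ∙ ε) {n : ℕ} (hn : m ^ n ≤ Module.annihilator A D)
    {r : ℕ} {b : Fin r → D}
    (hb : Submodule.span A (Set.range b) = Submodule.torsionBySet A D m) :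
    Module.Finite A (D →ₗ[A] E) ∧ (⊤ : Submodule A (D →ₗ[A] E)).spanFinrank ≤ r := by
  let _ := Ideal.Quotient.field m
  have hεmem : ε ∈ Submodule.torsionBySet A E m := hε ▸ Submodule.mem_span_singleton_self ε
  have hrank : Module.finrank (A ⧸ m) (Submodule.torsionBySet A E m) ≤ 1 := by
    refine finrank_le_one ⟨ε, hεmem⟩ fun e => ?_
    obtain ⟨a, ha⟩ := Submodule.mem_span_singleton.mp (hε.le e.2)
    exact ⟨Ideal.Quotient.mk m a, Subtype.ext ha⟩
  have : Module.Finite (A ⧸ m) (Submodule.torsionBySet A E m) := by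
    have : Module.Finite A (Submodule.torsionBySet A E m) := by rw [hε]; infer_instance
    exact Module.Finite.of_restrictScalars_finite A (A ⧸ m) _
  have hsocle (f : D →ₗ[A] E) (i : Fin r) : f (b i) ∈ Submodule.torsionBySet A E m := by
    have hbi : b i ∈ Submodule.torsionBySet A D m := hb ▸ Submodule.subset_span ⟨i, rfl⟩
    rw [Submodule.mem_torsionBySet_iff] at hbi ⊢
    exact fun a => by rw [← map_smul, hbi, map_zero]
  let ρ : (D →ₗ[A] E) →ₗ[A] (Fin r → Submodule.torsionBySet A E m) :=
    LinearMap.pi fun i => (LinearMap.applyₗ (b i)).codRestrict _ fun f => hsocle f i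
  have hρ : LinearMap.ker ρ ≤ m • ⊤ := fun f hf => by
    refine mem_smul_top_of_torsionBySet_le_ker hfg (hb ▸ Submodule.span_le.mpr ?_)
    rintro _ ⟨i, rfl⟩
    exact congrArg Subtype.val (congrFun hf i)
  obtain ⟨s, hs, hcard, hsup⟩ :=
    exists_finite_span_sup_ker_eq_top (K := A ⧸ m) Ideal.Quotient.mk_surjective ρ
  have hdual : m ^ n ≤ Module.annihilator A (D →ₗ[A] E) :=
    hn.trans (annihilator_le_annihilator_linearMap D E)
  have hspan : Submodule.span A s = ⊤ :=
    eq_top_of_sup_smul_eq_top hdual (top_le_iff.mp (hsup.symm.le.trans (sup_le_sup_left hρ _)))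
  rw [Module.finrank_pi_fintype] at hcard
  refine ⟨⟨Submodule.fg_def.mpr ⟨s, hs, hspan⟩⟩, ?_⟩
  rw [← hspan]
  refine (Submodule.spanFinrank_span_le_ncard_of_finite hs).trans (hcard.trans ?_)
  refine (Finset.sum_le_card_nsmul _ _ 1 fun _ _ => hrank).trans_eq (by simp)

variable [IsLocalRing A]

open IsLocalRing

lemma annihilator_dual_le (hε0 : ε ≠ 0)
    (hε : Submodule.torsionBySet A E (maximalIdeal A) = A ∙ ε) :
    Module.annihilator A (D →ₗ[A] E) ≤ Module.annihilator A D := fun a ha => by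
  rw [Module.mem_annihilator] at ha ⊢
  intro d
  by_contra hd
  have hεmem := (Submodule.mem_torsionBySet_iff _ _).mp
    (hε.ge (Submodule.mem_span_singleton_self ε))
  obtain ⟨f, hf⟩ := exists_comp_eq_of_ker_le_ker (LinearMap.toSpanSingleton A D (a • d))
    (LinearMap.toSpanSingleton A E ε) fun c hc => hεmem ⟨c, (mem_maximalIdeal c).mpr fun hu =>
      hd (hu.smul_eq_zero.mp hc)⟩
  refine hε0 ?_
  calc ε = f (a • d) := by simpa using (LinearMap.congr_fun hf 1).symm
    _ = (a • f) d := by rw [map_smul, LinearMap.smul_apply]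
    _ = 0 := by rw [ha, LinearMap.zero_apply]

theorem pow_mem_sup_annihilator_of_torsionBySet_le [IsNoetherianRing A] {n r : ℕ} {b : Fin r → D}
    (hn : maximalIdeal A ^ n ≤ Module.annihilator A D)
    (hb : Submodule.span A (Set.range b) = Submodule.torsionBySet A D (maximalIdeal A))
    {X : Ideal A} {c : A} (hc : ∀ d ∈ Submodule.torsionBySet A D X, c • d = 0) :
    c ^ r ∈ X ⊔ Module.annihilator A D := by
  obtain ⟨E, _, _, ε, _, hε0, hε⟩ :=
    exists_injective_torsionBySet_eq_span_singleton (maximalIdeal A)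
  obtain ⟨_, hr⟩ := finite_dual_and_spanFinrank_le (IsNoetherian.noetherian _) hε hn hb
  refine Ideal.pow_mem_of_pow_mem _ ?_ hr
  refine sup_le_sup_left (annihilator_dual_le hε0 hε) X <|
    pow_spanFinrank_mem_sup_annihilator fun f => ?_
  refine mem_smul_top_of_torsionBySet_le_ker (IsNoetherian.noetherian X) fun d hd => ?_
  rw [LinearMap.mem_ker, LinearMap.smul_apply, ← map_smul, hc d hd, map_zero]

end MatlisDual

section MaximalIdeal

open CategoryTheory Abelian RingTheory.Sequence IsLocalRing

variable {S : Type u} [CommRing S] {M : ModuleCat.{u} S} {rs : List S}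

lemma range_precomp_mk₀_factor_eq_torsionBySet (hrs : IsWeaklyRegular M rs) {I J : Ideal S}
    (hIJ : I ≤ J) (hJ : J.FG) (hI : Ideal.ofList rs ≤ I.radical) :
    LinearMap.range ((Ext.mk₀ (ModuleCat.ofHom (Submodule.factor hIJ))).precompOfLinear S M
      (zero_add rs.length)) =
        Submodule.torsionBySet S (Ext (ModuleCat.of S (S ⧸ I)) M rs.length) J := by
  ext d
  rw [Submodule.mem_torsionBySet_iff]
  refine ⟨?_, fun hd => exists_mk₀_factor_comp_eq hrs hIJ hJ hI d fun j hj => hd ⟨j, hj⟩⟩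
  rintro ⟨d', rfl⟩ ⟨j, hj⟩
  have hj' : j ∈ Module.annihilator S (ModuleCat.of S (S ⧸ J)) :=
    Ideal.annihilator_quotient.ge hj
  rw [← map_smul, Module.mem_annihilator.mp (annihilator_le_annihilator_ext _ M _ hj') d', map_zero]

lemma smul_eq_zero_of_mem_torsionBySet_ext [IsNoetherianRing S] (hrs : IsWeaklyRegular M rs)
    {I : Ideal S} (hI : Ideal.ofList rs ≤ I.radical) {c : S}
    (hc : ∀ y ∈ Submodule.torsionBySet S (M ⧸ (Ideal.ofList rs • ⊤ : Submodule S M)) I, c • y = 0)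
    {d : Ext (ModuleCat.of S (S ⧸ I)) M rs.length}
    (hd : d ∈ Submodule.torsionBySet S _ (Ideal.ofList rs : Set S)) : c • d = 0 := by
  have hann : Module.annihilator S (S ⧸ (I ⊔ Ideal.ofList rs)) = I ⊔ Ideal.ofList rs :=
    Ideal.annihilator_quotient
  have hdJ : I ⊔ Ideal.ofList rs ≤ (S ∙ d).annihilator := by
    refine sup_le (fun x hx => ?_) fun x hx => ?_ <;> rw [Submodule.mem_annihilator_span_singleton]
    · exact Module.mem_annihilator.mp (annihilator_le_annihilator_ext
        (ModuleCat.of S (S ⧸ I)) M _ (Ideal.annihilator_quotient.ge hx)) d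
    · exact (Submodule.mem_torsionBySet_iff _ _).mp hd ⟨x, hx⟩
  obtain ⟨d', rfl⟩ := exists_mk₀_factor_comp_eq hrs le_sup_left (IsNoetherian.noetherian _) hI d
    fun j hj => (Submodule.mem_annihilator_span_singleton _ _).mp (hdJ hj)
  have hcHom : c ∈ Module.annihilator S ((S ⧸ (I ⊔ Ideal.ofList rs)) →ₗ[S]
      M ⧸ (Ideal.ofList rs • ⊤ : Submodule S M)) := by
    refine Module.mem_annihilator.mpr fun f => LinearMap.ext fun t => hc (f t) ?_
    refine (Submodule.mem_torsionBySet_iff _ _).mpr fun ⟨a, ha⟩ => ?_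
    rw [← map_smul, Module.mem_annihilator.mp (hann.ge (Ideal.mem_sup_left ha)), map_zero]
  have hcExt := annihilator_linearMap_le_annihilator_ext hrs
    (T := ModuleCat.of S (S ⧸ (I ⊔ Ideal.ofList rs))) (le_sup_right.trans hann.ge) hcHom
  rw [← Ext.comp_smul, Module.mem_annihilator.mp hcExt d', Ext.comp_zero]

lemma exists_forall_torsionBySet_pow_le (m : Ideal S) (N : Type*) [AddCommGroup N] [Module S N]
    [IsNoetherian S N] :
    ∃ e, ∀ n, Submodule.torsionBySet S N (m ^ n : Ideal S) ≤
      Submodule.torsionBySet S N (m ^ e : Ideal S) := by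
  let T : ℕ →o Submodule S N :=
    { toFun := fun n => Submodule.torsionBySet S N (m ^ n : Ideal S)
      monotone' := fun i j hij => Submodule.torsionBySet_le_torsionBySet_pow i j hij m }
  obtain ⟨e, he⟩ := monotone_stabilizes_iff_noetherian.mpr ‹IsNoetherian S N› T
  refine ⟨e, fun n => ?_⟩
  rcases le_total n e with hne | hen
  · exact T.monotone hne
  · exact (he n hen).ge

variable {A : Type u} [CommRing A] [IsLocalRing A] [IsNoetherianRing A]

lemma iInf_sup_maximalIdeal_pow_le (X : Ideal A) : ⨅ n, X ⊔ maximalIdeal A ^ n ≤ X := by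
  intro c hc
  rw [← Ideal.Quotient.eq_zero_iff_mem, ← Submodule.mem_bot A,
    ← Ideal.iInf_pow_smul_eq_bot_of_isLocalRing (M := A ⧸ X) (maximalIdeal A)
      (Ideal.IsPrime.ne_top inferInstance), Submodule.mem_iInf]
  intro n
  obtain ⟨x, hx, y, hy, rfl⟩ := Submodule.mem_sup.mp (Submodule.mem_iInf _ |>.mp hc n)
  rw [map_add, Ideal.Quotient.eq_zero_iff_mem.mpr hx, zero_add, ← mul_one y]
  exact Submodule.smul_mem_smul (N := (⊤ : Submodule A (A ⧸ X))) hy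
    (Submodule.mem_top (x := Ideal.Quotient.mk X 1))

theorem maximalIdeal_le_radical_ofList {rs : List A} (hrs : IsWeaklyRegular A rs)
    (hmem : Ideal.ofList rs ≤ maximalIdeal A)
    {I : ℕ → Ideal A} (hI : Ideal.AreCofinal I fun k => maximalIdeal A ^ k)
    (hfaith : ∀ k, Module.annihilator A
      (Ext (ModuleCat.of A (A ⧸ I k)) (ModuleCat.of A A) rs.length) ≤ I k) :
    maximalIdeal A ≤ (Ideal.ofList rs).radical := by
  obtain ⟨r, g, hg⟩ := Module.Finite.exists_fin (R := A)
    (M := Ext (ModuleCat.of A (A ⧸ maximalIdeal A)) (ModuleCat.of A A) rs.length)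
  obtain ⟨e, he⟩ := exists_forall_torsionBySet_pow_le (maximalIdeal A)
    (ModuleCat.of A A ⧸ (Ideal.ofList rs • ⊤ : Submodule A (ModuleCat.of A A)))
  have hpow : ∀ c ∈ maximalIdeal A ^ e, c ^ r ∈ Ideal.ofList rs := by
    refine fun c hc => iInf_sup_maximalIdeal_pow_le _ ((Submodule.mem_iInf _).mpr fun n => ?_)
    obtain ⟨k, hk⟩ := hI.2 (n + 1)
    have hkm : I k ≤ maximalIdeal A := hk.trans (Ideal.pow_le_self n.succ_ne_zero)
    refine sup_le_sup_left ((hfaith k).trans (hk.trans (Ideal.pow_le_pow_right n.le_succ))) _ ?_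
    obtain ⟨l, hl⟩ := hI.1 k
    have hrad : Ideal.ofList rs ≤ (I k).radical :=
      hmem.trans fun x hx => ⟨l, hl (Ideal.pow_mem_pow hx l)⟩
    have hsocle := range_precomp_mk₀_factor_eq_torsionBySet (M := ModuleCat.of A A) hrs hkm
      (IsNoetherian.noetherian _) hrad
    rw [← Submodule.map_top, ← hg, Submodule.map_span, ← Set.range_comp] at hsocle
    refine pow_mem_sup_annihilator_of_torsionBySet_le (n := l) (hl.trans ?_) hsocle fun d hd =>
      smul_eq_zero_of_mem_torsionBySet_ext hrs hrad (fun y hy => ?_) hd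
    · exact Ideal.annihilator_quotient.ge.trans
        (annihilator_le_annihilator_ext (ModuleCat.of A (A ⧸ I k)) _ _)
    · exact (Submodule.mem_torsionBySet_iff _ _).mp
        (he l (Submodule.torsionBySet_le_torsionBySet_of_subset hl hy)) ⟨c, hc⟩
  exact fun c hc => ⟨e * r, pow_mul c e r ▸ hpow _ (Ideal.pow_mem_pow hc e)⟩

end MaximalIdeal

section Height

open CategoryTheory RingTheory.Sequence

variable {R : Type u} [CommRing R] [IsNoetherianRing R] {a : Ideal R} {rs : List R}

lemma length_le_height_of_isWeaklyRegular (hrs : IsWeaklyRegular R rs)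
    (hmem : Ideal.ofList rs ≤ a) : (rs.length : ℕ∞) ≤ a.height := by
  rw [a.height_eq_inf_minimalPrimes]
  refine le_iInf₂ fun p hp => ?_
  have := hp.isPrime
  have hreg := hrs.isRegular_of_isLocalization_of_mem (Localization.AtPrime p) p
    fun x hx => hp.le (hmem (Ideal.subset_span hx))
  have hdim := ringKrullDim_add_length_eq_ringKrullDim_of_isRegular _ hreg
  rw [IsLocalization.AtPrime.ringKrullDim_eq_height p (Localization.AtPrime p), List.length_map]
    at hdim
  have := Ideal.Quotient.nontrivial_iff.mpr fun h : Ideal.ofList _ = ⊤ => hreg.2 <| by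
    rw [h, Submodule.top_smul]
  exact WithBot.coe_le_coe.mp ((le_add_of_nonneg_left ringKrullDim_nonneg_of_nontrivial).trans_eq
    hdim)

lemma exists_isWeaklyRegular_length_eq_grade (ha : a ≠ ⊤) :
    ∃ rs : List R, IsWeaklyRegular R rs ∧ Ideal.ofList rs ≤ a ∧ (rs.length : ℕ∞) = a.grade := by
  have : Nontrivial R := (Submodule.nontrivial_iff R).mp (nontrivial_of_ne _ _ ha)
  let s := {rs : List R // IsRegular R rs ∧ ∀ r ∈ rs, r ∈ a}
  have : Nonempty s := ⟨[], IsRegular.nil R R, by simp⟩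
  have hgrade : a.grade = ⨆ rs : s, (rs.1.length : ℕ∞) := by
    simp only [Ideal.grade, s, iSup_subtype, iSup_and]
  have hle : ⨆ rs : s, (rs.1.length : ℕ∞) ≤ a.height := iSup_le fun rs =>
    length_le_height_of_isWeaklyRegular rs.2.1.1 (Ideal.span_le.mpr rs.2.2)
  obtain ⟨rs, hrs⟩ := ENat.exists_eq_iSup_of_lt_top (hle.trans_lt (Ideal.height_lt_top ha))
  exact ⟨rs, rs.2.1.1, Ideal.span_le.mpr rs.2.2, hrs.trans hgrade.symm⟩

lemma height_le_length_of_le_radical_ofList (hrs : Ideal.ofList rs ≠ ⊤)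
    (ha : a ≤ (Ideal.ofList rs).radical) : a.height ≤ rs.length := by
  classical
  have hspan : Ideal.ofList rs = Submodule.span R (rs.toFinset : Set R) := by
    rw [List.coe_toFinset]
  calc a.height ≤ (Ideal.ofList rs).radical.height := Ideal.height_mono ha
    _ = (Ideal.ofList rs).height := by
      rw [Ideal.height_eq_inf_minimalPrimes, Ideal.radical_minimalPrimes,
        ← Ideal.height_eq_inf_minimalPrimes]
    _ ≤ (Ideal.ofList rs).spanFinrank := Ideal.height_le_spanFinrank _ hrs
    _ ≤ rs.toFinset.card := by
      rw [hspan, ← Set.ncard_coe_finset]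
      exact Nat.cast_le.mpr (Submodule.spanFinrank_span_le_ncard_of_finite (Finset.finite_toSet _))
    _ ≤ rs.length := Nat.cast_le.mpr rs.toFinset_card_le

lemma areCofinal_map_localization_atPrime {p : Ideal R} [p.IsPrime] (hp : p ∈ a.minimalPrimes)
    {I : ℕ → Ideal R} (hI : Ideal.AreCofinal I fun k => a ^ k) :
    Ideal.AreCofinal (fun k => (I k).map (algebraMap R (Localization.AtPrime p)))
      fun k => IsLocalRing.maximalIdeal (Localization.AtPrime p) ^ k := by
  let A := Localization.AtPrime p
  let ι := algebraMap R A
  have ham : a.map ι ≤ IsLocalRing.maximalIdeal A :=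
    (Ideal.map_mono hp.le).trans_eq (Localization.AtPrime.map_eq_maximalIdeal (I := p))
  obtain ⟨N, hN⟩ : ∃ N, IsLocalRing.maximalIdeal A ^ N ≤ a.map ι := by
    refine Ideal.exists_pow_le_of_le_radical_of_fg ?_ (IsNoetherian.noetherian _)
    rw [IsLocalization.AtPrime.radical_map_of_mem_minimalPrimes A p a hp,
      Localization.AtPrime.map_eq_maximalIdeal]
  refine ⟨fun k => ?_, fun n => (hI.2 n).imp fun k hk => ?_⟩
  · obtain ⟨l, hl⟩ := hI.1 k
    refine ⟨N * l, ?_⟩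
    calc IsLocalRing.maximalIdeal A ^ (N * l) ≤ a.map ι ^ l :=
          (pow_mul _ N l).trans_le (Ideal.pow_right_mono hN l)
      _ = (a ^ l).map ι := (Ideal.map_pow ι a l).symm
      _ ≤ (I k).map ι := Ideal.map_mono hl
  · calc (I k).map ι ≤ (a ^ n).map ι := Ideal.map_mono hk
      _ = a.map ι ^ n := Ideal.map_pow ι a n
      _ ≤ IsLocalRing.maximalIdeal A ^ n := Ideal.pow_right_mono ham n

theorem height_le_length_of_hasProjectiveDimensionLE (ha : a ≠ ⊤) (hrs : IsWeaklyRegular R rs)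
    (hmem : Ideal.ofList rs ≤ a) {I : ℕ → Ideal R} (hI : Ideal.AreCofinal I fun k => a ^ k)
    (hpd : ∀ k, HasProjectiveDimensionLE (ModuleCat.of R (R ⧸ I k)) rs.length) :
    a.height ≤ rs.length := by
  obtain ⟨p, hp⟩ := Ideal.nonempty_minimalPrimes ha
  have := hp.isPrime
  let A := Localization.AtPrime p
  let ι := algebraMap R A
  have hlen : (rs.map ι).length = rs.length := List.length_map _
  have hreg : IsWeaklyRegular A (rs.map ι) := hrs.of_isLocalization A p.primeCompl
  have hmemA : Ideal.ofList (rs.map ι) ≤ IsLocalRing.maximalIdeal A := by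
    rw [← Ideal.map_ofList, ← Localization.AtPrime.map_eq_maximalIdeal]
    exact Ideal.map_mono (hmem.trans hp.le)
  have hIA := areCofinal_map_localization_atPrime hp hI
  have hfaith (k : ℕ) : Module.annihilator A (Abelian.Ext (ModuleCat.of A (A ⧸ (I k).map ι))
      (ModuleCat.of A A) (rs.map ι).length) ≤ (I k).map ι := by
    obtain ⟨l, hl⟩ := hIA.1 k
    have hrad : Ideal.ofList (rs.map ι) ≤ ((I k).map ι).radical :=
      hmemA.trans fun x hx => ⟨l, hl (Ideal.pow_mem_pow hx l)⟩
    exact annihilator_ext_quotient_self_le hreg hrad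
      (hasProjectiveDimensionLE_quotient_map ι hreg hrad le_rfl (hlen ▸ hpd k))
  calc a.height ≤ p.height := Ideal.height_mono hp.le
    _ = (IsLocalRing.maximalIdeal A).height := WithBot.coe_injective <|
      (IsLocalization.AtPrime.ringKrullDim_eq_height p A).symm.trans
        IsLocalRing.maximalIdeal_height_eq_ringKrullDim.symm
    _ ≤ (rs.map ι).length := height_le_length_of_le_radical_ofList
      (ne_top_of_le_ne_top Ideal.IsPrime.ne_top' hmemA)
      (maximalIdeal_le_radical_ofList hreg hmemA hIA hfaith)
    _ = rs.length := by rw [hlen]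

theorem cohomologicalDimension_eq_length (ha : a ≠ ⊤) (hrs : IsWeaklyRegular R rs)
    (hmem : Ideal.ofList rs ≤ a) {I : ℕ → Ideal R} (hI : Ideal.AreCofinal I fun k => a ^ k)
    (hpd : ∀ k, HasProjectiveDimensionLE (ModuleCat.of R (R ⧸ I k)) rs.length) :
    a.cohomologicalDimension = rs.length := by
  have hle : a.cohomologicalDimension ≤ rs.length :=
    iInf₂_le _ fun M i => isZero_localCohomology_of_hasProjectiveDimensionLE hI hpd
  refine hle.antisymm (le_iInf₂ fun c hc => Nat.cast_le.mpr ?_)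
  obtain ⟨j, hj⟩ := hI.2 1
  obtain ⟨k, hk⟩ := hI.1 j
  have hann := annihilator_ext_quotient_self_le hrs
    (hmem.trans fun x hx => ⟨k, hk (Ideal.pow_mem_pow hx k)⟩) (hpd j)
  obtain ⟨e, he⟩ : ∃ e : Abelian.Ext (ModuleCat.of R (R ⧸ I j)) (ModuleCat.of R R) rs.length,
      e ≠ 0 := by
    by_contra! h
    refine ha ((Ideal.eq_top_iff_one a).mpr (pow_one a ▸ hj (hann ?_)))
    exact Module.mem_annihilator.mpr fun e => by rw [h e, smul_zero]
  exact not_lt.mp fun h => not_isZero_localCohomology_of_ext_ne_zero hrs hmem hk he (hc _ _ h)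

lemma projectiveDimension_quotient_map_le_grade (ha : a ≠ ⊤) {S : Type u} [CommRing S]
    (φ : S →+* R) {b : Ideal S}
    (hb : projectiveDimension (ModuleCat.of S (S ⧸ b)) ≤ a.grade) {l : ℕ} (hl : a ^ l ≤ b.map φ) :
    projectiveDimension (ModuleCat.of R (R ⧸ b.map φ)) ≤ a.grade := by
  obtain ⟨rs, hrs, hmem, hlen⟩ := exists_isWeaklyRegular_length_eq_grade ha
  rw [← hlen] at hb ⊢
  exact (projectiveDimension_le_iff _ _).mpr (hasProjectiveDimensionLE_quotient_map φ hrs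
    (hmem.trans fun x hx => ⟨l, hl (Ideal.pow_mem_pow hx l)⟩) le_rfl
      ((projectiveDimension_le_iff _ _).mp hb))

lemma ne_top_of_isPerfect {R : Type u} [CommRing R] {a : Ideal R} (ha : a.IsPerfect) : a ≠ ⊤ := by
  rintro rfl
  have := Ideal.Quotient.subsingleton_iff.mpr (rfl : (⊤ : Ideal R) = ⊤)
  rw [Ideal.IsPerfect, (projectiveDimension_eq_bot_iff _).mpr
    (ModuleCat.isZero_of_subsingleton (ModuleCat.of R (R ⧸ (⊤ : Ideal R))))] at ha
  exact WithBot.bot_ne_coe ha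

end Height

theorem lemma2p1_general {R : Type u} [CommRing R] [IsNoetherianRing R] (a : Ideal R)
    (ha : a ≠ ⊤) (I : ℕ → Ideal R) (hI : Ideal.AreCofinal I (fun k => a ^ k))
    (hpd : ∀ k, CategoryTheory.projectiveDimension (ModuleCat.of R (R ⧸ I k)) ≤ a.grade) :
    a.cohomologicalDimension = a.height := by
  obtain ⟨rs, hrs, hmem, hlen⟩ := exists_isWeaklyRegular_length_eq_grade ha
  rw [← hlen] at hpd
  replace hpd k := (CategoryTheory.projectiveDimension_le_iff _ _).mp (hpd k)
  rw [cohomologicalDimension_eq_length ha hrs hmem hI hpd]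
  exact (length_le_height_of_isWeaklyRegular hrs hmem).antisymm
    (height_le_length_of_hasProjectiveDimensionLE ha hrs hmem hI hpd)

theorem lemma2p1 {R : Type u} [CommRing R] [IsNoetherianRing R] (a : Ideal R)
    (ha : a.IsPerfect) (φ : ℕ → R →+* R) (hφ_zero : φ 0 = RingHom.id R)
    (hφ_anti : ∀ i j : ℕ, j ≤ i → φ i '' (a : Set R) ⊆ φ j '' (a : Set R))
    (hφ_cofinal : Ideal.AreCofinal (fun k => a.map (φ k)) (fun k => a ^ k)) :
    a.cohomologicalDimension = a.height :=
  lemma2p1_general a (ne_top_of_isPerfect ha) _ hφ_cofinal fun k => (hφ_cofinal.1 k).elim fun _ =>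
    projectiveDimension_quotient_map_le_grade (ne_top_of_isPerfect ha) (φ k) ha.le
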